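/- Let $V$ be a finite non-empty set of points in the plane $\mathbb R^2$, and let $G$ be the unit disk graph on $V$: its vertex set is $V$, and two distinct points of $V$ are adjacent if and only if their Euclidean distance is at most $1$. Let $\alpha(G)$ be the largest size of a set of pairwise non-adjacent vertices of $G$, and suppose that $\alpha(G)\le 2$. Call a (possibly empty) set of pairwise adjacent vertices of $G$ a clique. Then: 1. There are three cliques $A,B,C$ of $G$, not necessarily distinct, such that $V=A\cup B\cup C$ and $A\cap B\neq\emptyset$. 2. There are three pairwise disjoint cliques $A,B,C$ of $G$ such that $V=A\cup B\cup C$ and such that $|A|,|B|,|C|$ are not all equal. 3. The clique partition number of $G$, that is, the chromatic number of the complement of $G$, is at most $3$. -/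

import Mathlib

/-- The Euclidean plane. -/
abbrev Plane : Type := EuclideanSpace ℝ (Fin 2)

/-- The unit disk graph on a set `V` of points in the plane (distance model): the vertices are
the points of `V` themselves, and two distinct vertices are adjacent if and only if their
Euclidean distance is at most `1`. -/
def unitDiskGraph (V : Set Plane) : SimpleGraph V where
  Adj x y := x ≠ y ∧ dist (x : Plane) (y : Plane) ≤ 1
  symm := ⟨fun _ _ h => ⟨h.1.symm, by rw [dist_comm]; exact h.2⟩⟩
  loopless := ⟨fun _ h => h.1 rfl⟩

/-- The clique partition number of a graph: the chromatic number of its complement. -/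
noncomputable def cliquePartitionNumber {V : Type*} (G : SimpleGraph V) : ℕ∞ :=
  Gᶜ.chromaticNumber

/-! The vertices at distance more than 1 from a given vertex form a clique: two non-adjacent ones
would complete an independent triple. If some vertices `a`, `b` are at least √3 apart, their common
neighbours form a clique too. Every other vertex is far from `a` or from `b`, and adding `a` to the
common neighbours makes this clique overlap the one far from `b`. Otherwise Helly's theorem puts `V`
in a unit disc, which can be moved until some `v` in `V` lies on its boundary. The closed
neighbourhood of `v` then lies in the lens of two unit discs whose centres are 1 apart, and the two
halves of the lens give cliques sharing `v`; the vertices far from `v` are the third. The overlap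
yields unequal sizes, since a shared vertex may be assigned to either clique. -/

section Cliques

variable {W : Type*} (G : SimpleGraph W)

/-- In a graph of independence number at most two, the vertices that are neither equal nor
adjacent to a given vertex form a clique. -/
theorem SimpleGraph.isClique_nonneighbors [Finite W] (hα : G.indepNum ≤ 2) (v : W) :
    G.IsClique {x | x ≠ v ∧ ¬ G.Adj v x} := by
  classical
  intro x hx y hy hxy
  by_contra hadj
  have hI : G.IsIndepSet (({v, x, y} : Finset W) : Set W) := by
    intro p hp q hq hpq
    simp only [Finset.coe_insert, Finset.coe_singleton, Set.mem_insert_iff,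
      Set.mem_singleton_iff] at hp hq
    have h1 := hx.2
    have h2 := hy.2
    have h1' : ¬ G.Adj x v := fun h => h1 h.symm
    have h2' : ¬ G.Adj y v := fun h => h2 h.symm
    have h3' : ¬ G.Adj y x := fun h => hadj h.symm
    rcases hp with rfl | rfl | rfl <;> rcases hq with rfl | rfl | rfl <;>
      first | exact absurd rfl hpq | assumption
  have : Fintype W := Fintype.ofFinite W
  have hc := hI.card_le_indepNum
  rw [Finset.card_eq_three.mpr ⟨v, x, y, hx.1.symm, hy.1.symm, hxy, rfl⟩] at hc
  omega

/-- If two of the cliques in a cover by three cliques overlap, then there is a partition into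
three cliques that do not all have the same size. -/
theorem SimpleGraph.exists_clique_partition_ncard_ne [Finite W] {A B C : Set W}
    (hA : G.IsClique A) (hB : G.IsClique B) (hC : G.IsClique C)
    (hcover : A ∪ B ∪ C = Set.univ) (hAB : (A ∩ B).Nonempty) :
    ∃ A B C : Set W, G.IsClique A ∧ G.IsClique B ∧ G.IsClique C ∧
      A ∪ B ∪ C = Set.univ ∧ Disjoint A B ∧ Disjoint A C ∧ Disjoint B C ∧
      ¬ (A.ncard = B.ncard ∧ B.ncard = C.ncard) := by
  obtain ⟨x, hxA, hxB⟩ := hAB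
  have hcov : ∀ y, y ∈ A ∨ y ∈ B ∨ y ∈ C := fun y => by
    have : y ∈ A ∪ B ∪ C := hcover ▸ Set.mem_univ y
    simpa [or_assoc] using this
  by_cases h : A.ncard = (B \ A).ncard
  -- Moving `x` from the first part to the second turns equal sizes into sizes differing by two.
  · refine ⟨A \ {x}, insert x (B \ A), C \ (A ∪ B), hA.subset Set.sdiff_subset,
      hB.subset (Set.insert_subset hxB Set.sdiff_subset), hC.subset Set.sdiff_subset,
      ?_, ?_, ?_, ?_, ?_⟩
    · ext y
      have := hcov y
      by_cases hy : y = x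
      · simp [hy]
      · simp [hy]; tauto
    · rw [Set.disjoint_left]
      rintro y ⟨hy, hyx⟩ hy'
      rcases hy' with rfl | hy'
      · exact hyx rfl
      · exact hy'.2 hy
    · rw [Set.disjoint_left]
      rintro y ⟨hy, -⟩ hy'
      exact hy'.2 (Or.inl hy)
    · rw [Set.disjoint_left]
      rintro y hy hy'
      rcases hy with rfl | hy
      · exact hy'.2 (Or.inl hxA)
      · exact hy'.2 (Or.inr hy.1)
    · rintro ⟨h1, -⟩
      rw [Set.ncard_insert_of_notMem (fun hx => hx.2 hxA), ← h,
        ← Set.ncard_sdiff_singleton_add_one hxA] at h1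
      omega
  · refine ⟨A, B \ A, C \ (A ∪ B), hA, hB.subset Set.sdiff_subset, hC.subset Set.sdiff_subset,
      ?_, Set.disjoint_sdiff_right, ?_, ?_, fun h' => h h'.1⟩
    · ext y
      have := hcov y
      simp; tauto
    · exact Set.disjoint_sdiff_right.mono_left Set.subset_union_left
    · exact Set.disjoint_sdiff_right.mono_left (Set.sdiff_subset.trans Set.subset_union_right)

/-- A graph covered by three cliques has clique partition number at most three. -/
theorem cliquePartitionNumber_le_three {A B C : Set W}
    (hA : G.IsClique A) (hB : G.IsClique B) (hC : G.IsClique C)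
    (hcover : A ∪ B ∪ C = Set.univ) : cliquePartitionNumber G ≤ 3 := by
  classical
  have hcov : ∀ y, y ∈ A ∨ y ∈ B ∨ y ∈ C := fun y => by
    have : y ∈ A ∪ B ∪ C := hcover ▸ Set.mem_univ y
    simpa [or_assoc] using this
  let col : W → Fin 3 := fun y => if y ∈ A then 0 else if y ∈ B then 1 else 2
  have hcol : Gᶜ.Colorable 3 := by
    refine ⟨SimpleGraph.Coloring.mk col ?_⟩
    intro p q hpq heq
    rw [SimpleGraph.compl_adj] at hpq
    have hp := hcov p
    have hq := hcov q
    apply hpq.2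
    by_cases pA : p ∈ A <;> by_cases qA : q ∈ A <;> by_cases pB : p ∈ B <;>
      by_cases qB : q ∈ B <;> simp [col, pA, qA, pB, qB] at heq hp hq <;>
      first
        | exact hA pA qA hpq.1
        | exact hB pB qB hpq.1
        | exact hC hp hq hpq.1
  exact hcol.chromaticNumber_le

end Cliques

/-! ### Lenses and unit discs in the plane -/

section Geometry

theorem Plane.dist_le_iff {r : ℝ} (hr : 0 ≤ r) (x y : Plane) :
    dist x y ≤ r ↔ (x 0 - y 0) ^ 2 + (x 1 - y 1) ^ 2 ≤ r ^ 2 := by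
  rw [EuclideanSpace.dist_eq, Fin.sum_univ_two, Real.dist_eq, Real.dist_eq, sq_abs, sq_abs,
    Real.sqrt_le_left hr]

theorem Plane.dist_le_one_iff (x y : Plane) :
    dist x y ≤ 1 ↔ (x 0 - y 0) ^ 2 + (x 1 - y 1) ^ 2 ≤ 1 := by
  simpa using Plane.dist_le_iff zero_le_one x y

/-- Two points within distance one of both `a` and `b` are within distance one of each other,
provided that `a` and `b` are at distance at least `√3`. -/
theorem Plane.dist_le_one_of_far {a b x y : Plane}
    (hab : 3 ≤ (a 0 - b 0) ^ 2 + (a 1 - b 1) ^ 2)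
    (hxa : dist x a ≤ 1) (hxb : dist x b ≤ 1) (hya : dist y a ≤ 1) (hyb : dist y b ≤ 1) :
    dist x y ≤ 1 := by
  rw [Plane.dist_le_one_iff] at *
  -- |x-a|² + |x-b|² + |y-a|² + |y-b|² = |x-y|² + |a-b|² + |x+y-a-b|².
  linarith [sq_nonneg (x 0 + y 0 - a 0 - b 0), sq_nonneg (x 1 + y 1 - a 1 - b 1)]

/-- Each half of the lens cut out by two unit discs centred at `(0, 0)` and `(1, 0)` has
diameter at most one. -/
theorem sq_dist_le_one_of_half_lens {p₁ p₂ q₁ q₂ : ℝ} (hp₂ : 0 ≤ p₂) (hq₂ : 0 ≤ q₂)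
    (hp : p₁ ^ 2 + p₂ ^ 2 ≤ 1) (hp' : (1 - p₁) ^ 2 + p₂ ^ 2 ≤ 1)
    (hq : q₁ ^ 2 + q₂ ^ 2 ≤ 1) (hq' : (1 - q₁) ^ 2 + q₂ ^ 2 ≤ 1) :
    (p₁ - q₁) ^ 2 + (p₂ - q₂) ^ 2 ≤ 1 := by
  have a1 : 0 ≤ p₁ := by nlinarith
  have a2 : 0 ≤ q₁ := by nlinarith
  have a3 : p₁ ≤ 1 := by nlinarith
  have a4 : q₁ ≤ 1 := by nlinarith
  -- In each case, both coordinates of p - q are dominated by those of p or q taken relative to one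
  -- of the two centres.
  rcases le_total p₁ q₁ with h | h <;> rcases le_total p₂ q₂ with h' | h'
  · nlinarith [mul_nonneg a1 (sub_nonneg.2 h), mul_nonneg hp₂ (sub_nonneg.2 h')]
  · nlinarith [mul_nonneg (sub_nonneg.2 a4) (sub_nonneg.2 h), mul_nonneg hq₂ (sub_nonneg.2 h')]
  · nlinarith [mul_nonneg (sub_nonneg.2 a3) (sub_nonneg.2 h), mul_nonneg hp₂ (sub_nonneg.2 h')]
  · nlinarith [mul_nonneg a2 (sub_nonneg.2 h), mul_nonneg hq₂ (sub_nonneg.2 h')]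

/-- Twice the signed area of the triangle `v`, `c`, `x`. -/
def Plane.signedArea (v c x : Plane) : ℝ :=
  (c 0 - v 0) * (x 1 - v 1) - (c 1 - v 1) * (x 0 - v 0)

/-- In the orthonormal frame with origin `v` and first axis towards `c`, `signedArea` is the second
coordinate, so `sq_dist_le_one_of_half_lens` applies, after a reflection if the signs are
nonpositive. -/
theorem Plane.dist_le_one_of_half_lens {v c x y : Plane} (hvc : dist v c = 1)
    (hs : 0 ≤ signedArea v c x ∧ 0 ≤ signedArea v c y ∨
      signedArea v c x ≤ 0 ∧ signedArea v c y ≤ 0)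
    (hxv : dist x v ≤ 1) (hxc : dist x c ≤ 1) (hyv : dist y v ≤ 1) (hyc : dist y c ≤ 1) :
    dist x y ≤ 1 := by
  rw [EuclideanSpace.dist_eq, Fin.sum_univ_two, Real.dist_eq, Real.dist_eq, sq_abs, sq_abs,
    Real.sqrt_eq_one] at hvc
  rw [Plane.dist_le_one_iff] at *
  simp only [signedArea] at hs
  set e₁ := c 0 - v 0 with he₁
  set e₂ := c 1 - v 1 with he₂
  have he : e₁ ^ 2 + e₂ ^ 2 = 1 := by rw [he₁, he₂]; linarith
  have key : ∀ s t : ℝ, (e₁ * s + e₂ * t) ^ 2 + (e₁ * t - e₂ * s) ^ 2 = s ^ 2 + t ^ 2 := by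
    intro s t
    linear_combination (s ^ 2 + t ^ 2) * he
  have key' : ∀ s t : ℝ, (1 - (e₁ * s + e₂ * t)) ^ 2 + (e₁ * t - e₂ * s) ^ 2 =
      (s - e₁) ^ 2 + (t - e₂) ^ 2 := by
    intro s t
    linear_combination (s ^ 2 + t ^ 2 - 1) * he
  have hc0 : c 0 = v 0 + e₁ := by rw [he₁]; ring
  have hc1 : c 1 = v 1 + e₂ := by rw [he₂]; ring
  have h1 := key (x 0 - v 0) (x 1 - v 1)
  have h2 := key' (x 0 - v 0) (x 1 - v 1)
  have h3 := key (y 0 - v 0) (y 1 - v 1)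
  have h4 := key' (y 0 - v 0) (y 1 - v 1)
  have h5 := key (x 0 - y 0) (x 1 - y 1)
  rw [hc0, hc1] at hxc hyc
  rcases hs with ⟨hx, hy⟩ | ⟨hx, hy⟩
  · have := sq_dist_le_one_of_half_lens (p₁ := e₁ * (x 0 - v 0) + e₂ * (x 1 - v 1))
      (q₁ := e₁ * (y 0 - v 0) + e₂ * (y 1 - v 1)) hx hy
      (by linarith) (by linarith) (by linarith) (by linarith)
    linarith
  · have := sq_dist_le_one_of_half_lens (p₁ := e₁ * (x 0 - v 0) + e₂ * (x 1 - v 1))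
      (q₁ := e₁ * (y 0 - v 0) + e₂ * (y 1 - v 1)) (neg_nonneg.2 hx) (neg_nonneg.2 hy)
      (by linarith) (by linarith) (by linarith) (by linarith)
    linarith

/-- Three points at mutual distances at most `√3`, two of which are at distance at most one,
lie in a common unit disc. -/
theorem Plane.exists_unit_disc_of_three {a b c : Plane}
    (hab : (a 0 - b 0) ^ 2 + (a 1 - b 1) ^ 2 ≤ 3)
    (hac : (a 0 - c 0) ^ 2 + (a 1 - c 1) ^ 2 ≤ 3)
    (hbc : dist b c ≤ 1) :
    ∃ o : Plane, dist o a ≤ 1 ∧ dist o b ≤ 1 ∧ dist o c ≤ 1 := by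
  wlog h : (a 0 - c 0) ^ 2 + (a 1 - c 1) ^ 2 ≤ (a 0 - b 0) ^ 2 + (a 1 - b 1) ^ 2 generalizing b c
  · have hcb : dist c b ≤ 1 := by rwa [dist_comm]
    obtain ⟨o, h1, h2, h3⟩ := this hac hab hcb (not_le.1 h).le
    exact ⟨o, h1, h3, h2⟩
  by_cases hm : ((a 0 + b 0) / 2 - c 0) ^ 2 + ((a 1 + b 1) / 2 - c 1) ^ 2 ≤ 1
  · refine ⟨!₂[(a 0 + b 0) / 2, (a 1 + b 1) / 2], ?_, ?_, ?_⟩ <;>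
      rw [Plane.dist_le_one_iff] <;> simp
    · nlinarith
    · nlinarith
    · exact hm
  -- By the median formula, the failure of `hm` forces |a-c|² > 1. The centre (3a+2b+2c)/7 has
  -- squared distance at most 48/49 from `a`, and (15|a-b|² + 10|b-c|² - 6|a-c|²)/49 < 1 from `b`;
  -- `c` is similar, using `h`.
  · rw [Plane.dist_le_one_iff] at hbc
    refine ⟨!₂[(3 * a 0 + 2 * b 0 + 2 * c 0) / 7, (3 * a 1 + 2 * b 1 + 2 * c 1) / 7],
      ?_, ?_, ?_⟩ <;> rw [Plane.dist_le_one_iff] <;> simp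
    · nlinarith [sq_nonneg (b 0 - c 0), sq_nonneg (b 1 - c 1)]
    · nlinarith
    · nlinarith

/-- A finite nonempty set contained in some unit disc has a point on the boundary circle of a
unit disc containing the set. -/
theorem Plane.exists_touching_unit_disc {V : Set Plane} (hfin : V.Finite) (hne : V.Nonempty)
    {o : Plane} (ho : ∀ x ∈ V, dist o x ≤ 1) :
    ∃ v ∈ V, ∃ c : Plane, dist v c = 1 ∧ ∀ x ∈ V, dist x c ≤ 1 := by
  -- `K` consists of the centres of unit discs containing `V`. A frontier point of `K` works: were
  -- all distances from it below 1, finiteness of `V` would make it interior.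
  let K : Set Plane := ⋂ x ∈ V, Metric.closedBall x 1
  have hKne : K.Nonempty := ⟨o, by simpa [K] using ho⟩
  have hKcl : IsClosed K := isClosed_biInter fun x _ => Metric.isClosed_closedBall
  have hKuniv : K ≠ Set.univ := by
    obtain ⟨w, hw⟩ := hne
    intro hK
    have hb : Bornology.IsBounded K :=
      Metric.isBounded_closedBall.subset (Set.biInter_subset_of_mem hw)
    rw [hK] at hb
    exact NormedSpace.unbounded_univ ℝ Plane hb
  obtain ⟨c, hc⟩ := nonempty_frontier_iff.2 ⟨hKne, hKuniv⟩
  have hcK : ∀ x ∈ V, dist x c ≤ 1 := by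
    have := hKcl.frontier_subset hc
    simpa [K, dist_comm] using this
  by_contra! hcon
  have hlt : ∀ x ∈ V, dist c x < 1 := fun x hx => by
    rw [dist_comm]
    exact lt_of_le_of_ne (hcK x hx) fun h => by
      obtain ⟨y, hy, hy'⟩ := hcon x hx c h
      exact absurd (hcK y hy) (not_le.2 hy')
  have hopen : IsOpen (⋂ x ∈ V, Metric.ball x (1 : ℝ)) :=
    hfin.isOpen_biInter fun x _ => Metric.isOpen_ball
  have hsub : (⋂ x ∈ V, Metric.ball x (1 : ℝ)) ⊆ K :=
    Set.iInter₂_mono fun x _ => Metric.ball_subset_closedBall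
  exact hc.2 (interior_maximal hsub hopen (by simpa using hlt))

/-- A finite set of points of the plane with mutual distances at most `√3`, among any three of
which two are at distance at most one, lies in a unit disc. -/
theorem Plane.exists_unit_disc {V : Set Plane} (hfin : V.Finite)
    (hd : ∀ a ∈ V, ∀ b ∈ V, (a 0 - b 0) ^ 2 + (a 1 - b 1) ^ 2 ≤ 3)
    (h3 : ∀ a ∈ V, ∀ b ∈ V, ∀ c ∈ V, dist a b ≤ 1 ∨ dist a c ≤ 1 ∨ dist b c ≤ 1) :
    ∃ o : Plane, ∀ x ∈ V, dist o x ≤ 1 := by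
  have hthree : ∀ a ∈ V, ∀ b ∈ V, ∀ c ∈ V,
      ∃ o : Plane, dist o a ≤ 1 ∧ dist o b ≤ 1 ∧ dist o c ≤ 1 := by
    intro a ha b hb c hc
    rcases h3 a ha b hb c hc with h | h | h
    · obtain ⟨o, h1, h2, h3⟩ := exists_unit_disc_of_three (hd c hc a ha) (hd c hc b hb) h
      exact ⟨o, h2, h3, h1⟩
    · obtain ⟨o, h1, h2, h3⟩ := exists_unit_disc_of_three (hd b hb a ha) (hd b hb c hc) h
      exact ⟨o, h2, h1, h3⟩
    · exact exists_unit_disc_of_three (hd a ha b hb) (hd a ha c hc) h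
  -- A common centre exists once every at most three of the discs meet; `hthree` with a repeated
  -- point handles pairs.
  obtain ⟨o, ho⟩ := Convex.helly_theorem' (𝕜 := ℝ) (s := hfin.toFinset)
    (F := fun x : Plane => Metric.closedBall x (1 : ℝ)) (fun x _ => convex_closedBall x 1) (by
      intro I hI hcard
      rw [finrank_euclideanSpace_fin] at hcard
      have hIV : ∀ x ∈ I, x ∈ V := fun x hx => hfin.mem_toFinset.1 (hI hx)
      interval_cases hn : I.card
      · rw [Finset.card_eq_zero.1 hn]
        simp
      · obtain ⟨a, rfl⟩ := Finset.card_eq_one.1 hn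
        exact ⟨a, by simp⟩
      · obtain ⟨a, b, -, rfl⟩ := Finset.card_eq_two.1 hn
        obtain ⟨o, h1, h2, -⟩ := hthree a (hIV a (by simp)) b (hIV b (by simp)) b
          (hIV b (by simp))
        exact ⟨o, by simp [h1, h2]⟩
      · obtain ⟨a, b, c, -, -, -, rfl⟩ := Finset.card_eq_three.1 hn
        obtain ⟨o, h1, h2, h3⟩ := hthree a (hIV a (by simp)) b (hIV b (by simp)) c
          (hIV c (by simp))
        exact ⟨o, by simp [h1, h2, h3]⟩)
  exact ⟨o, by simpa using ho⟩

end Geometry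

/-! ### Clique covers of unit disk graphs -/

section UnitDisk

variable {V : Set Plane}

theorem unitDiskGraph_isClique_nonneighbors (hfin : V.Finite)
    (hα : (unitDiskGraph V).indepNum ≤ 2) (v : V) :
    (unitDiskGraph V).IsClique {x : V | 1 < dist (x : Plane) v} := by
  have : Finite V := hfin
  refine SimpleGraph.IsClique.subset ?_ ((unitDiskGraph V).isClique_nonneighbors hα v)
  intro x hx
  rw [Set.mem_ofPred_eq] at hx
  refine ⟨?_, fun h => ?_⟩
  · rintro rfl
    rw [dist_self] at hx
    linarith
  · have h2 := h.2
    rw [dist_comm] at h2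
    exact absurd hx (not_lt.2 h2)

/-- Unit disk graphs of independence number at most two containing two vertices at distance at
least `√3`: the common neighbours of the two vertices form a clique. -/
theorem unitDiskGraph_exists_cliques_of_far (hfin : V.Finite)
    (hα : (unitDiskGraph V).indepNum ≤ 2) {a b : V}
    (hab : 3 ≤ ((a : Plane) 0 - (b : Plane) 0) ^ 2 + ((a : Plane) 1 - (b : Plane) 1) ^ 2) :
    ∃ A B C : Set V,
      (unitDiskGraph V).IsClique A ∧ (unitDiskGraph V).IsClique B ∧
      (unitDiskGraph V).IsClique C ∧
      A ∪ B ∪ C = Set.univ ∧ (A ∩ B).Nonempty := by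
  have hfar : 1 < dist (a : Plane) b := by
    rw [← not_le, Plane.dist_le_one_iff]
    linarith
  refine ⟨{x | 1 < dist (x : Plane) b},
    insert a {x | dist (x : Plane) a ≤ 1 ∧ dist (x : Plane) b ≤ 1},
    {x | 1 < dist (x : Plane) a}, unitDiskGraph_isClique_nonneighbors hfin hα b, ?_,
    unitDiskGraph_isClique_nonneighbors hfin hα a, ?_, a, hfar, Or.inl rfl⟩
  · intro x hx y hy hxy
    refine ⟨hxy, ?_⟩
    rcases hx with rfl | hx <;> rcases hy with rfl | hy
    · exact absurd rfl hxy
    · rw [dist_comm]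
      exact hy.1
    · exact hx.1
    · exact Plane.dist_le_one_of_far hab hx.1 hx.2 hy.1 hy.2
  · rw [Set.eq_univ_iff_forall]
    intro x
    by_cases h1 : dist (x : Plane) b ≤ 1
    · by_cases h2 : dist (x : Plane) a ≤ 1
      · exact Or.inl (Or.inr (Or.inr ⟨h2, h1⟩))
      · exact Or.inr (not_le.1 h2)
    · exact Or.inl (Or.inl (not_le.1 h1))

/-- If the vertex `v` lies on the boundary of a unit disc that contains all vertices, then the
closed neighbourhood of `v` is the union of two cliques containing `v`. -/
theorem unitDiskGraph_exists_cliques_of_touching (hfin : V.Finite)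
    (hα : (unitDiskGraph V).indepNum ≤ 2) (v : V) {c : Plane} (hvc : dist (v : Plane) c = 1)
    (hc : ∀ x ∈ V, dist x c ≤ 1) :
    ∃ A B C : Set V,
      (unitDiskGraph V).IsClique A ∧ (unitDiskGraph V).IsClique B ∧
      (unitDiskGraph V).IsClique C ∧
      A ∪ B ∪ C = Set.univ ∧ (A ∩ B).Nonempty := by
  refine ⟨{x | dist (x : Plane) v ≤ 1 ∧ 0 ≤ Plane.signedArea v c x},
    {x | dist (x : Plane) v ≤ 1 ∧ Plane.signedArea v c x ≤ 0},
    {x | 1 < dist (x : Plane) v}, ?_, ?_, unitDiskGraph_isClique_nonneighbors hfin hα v,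
    ?_, v, ?_, ?_⟩
  · intro x hx y hy hxy
    exact ⟨hxy, Plane.dist_le_one_of_half_lens hvc (Or.inl ⟨hx.2, hy.2⟩) hx.1 (hc x x.2)
      hy.1 (hc y y.2)⟩
  · intro x hx y hy hxy
    exact ⟨hxy, Plane.dist_le_one_of_half_lens hvc (Or.inr ⟨hx.2, hy.2⟩) hx.1 (hc x x.2)
      hy.1 (hc y y.2)⟩
  · rw [Set.eq_univ_iff_forall]
    intro x
    by_cases h1 : dist (x : Plane) v ≤ 1
    · rcases le_total 0 (Plane.signedArea v c x) with h | h
      · exact Or.inl (Or.inl ⟨h1, h⟩)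
      · exact Or.inl (Or.inr ⟨h1, h⟩)
    · exact Or.inr (not_le.1 h1)
  · simp [Plane.signedArea]
  · simp [Plane.signedArea]

theorem unitDiskGraph_exists_dist_le_one_of_three (hfin : V.Finite)
    (hα : (unitDiskGraph V).indepNum ≤ 2) (a : Plane) (ha : a ∈ V) (b : Plane) (hb : b ∈ V)
    (c : Plane) (hc : c ∈ V) : dist a b ≤ 1 ∨ dist a c ≤ 1 ∨ dist b c ≤ 1 := by
  by_contra! h
  have hbc : (⟨b, hb⟩ : V) ≠ ⟨c, hc⟩ := by
    intro hbc
    rw [Subtype.mk.injEq] at hbc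
    have := h.2.2
    rw [hbc, dist_self] at this
    linarith
  have hb' : (⟨b, hb⟩ : V) ∈ {x : V | 1 < dist (x : Plane) a} := by
    simpa [dist_comm] using h.1
  have hc' : (⟨c, hc⟩ : V) ∈ {x : V | 1 < dist (x : Plane) a} := by
    simpa [dist_comm] using h.2.1
  have := unitDiskGraph_isClique_nonneighbors hfin hα ⟨a, ha⟩ hb' hc' hbc
  exact absurd this.2 (not_le.2 h.2.2)

/-- A unit disk graph of independence number at most two is covered by three cliques, two of
which overlap. -/
theorem unitDiskGraph_exists_cliques (hfin : V.Finite) (hne : V.Nonempty)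
    (hα : (unitDiskGraph V).indepNum ≤ 2) :
    ∃ A B C : Set V,
      (unitDiskGraph V).IsClique A ∧ (unitDiskGraph V).IsClique B ∧
      (unitDiskGraph V).IsClique C ∧
      A ∪ B ∪ C = Set.univ ∧ (A ∩ B).Nonempty := by
  by_cases h : ∃ a ∈ V, ∃ b ∈ V, 3 ≤ (a 0 - b 0) ^ 2 + (a 1 - b 1) ^ 2
  · obtain ⟨a, ha, b, hb, hab⟩ := h
    exact unitDiskGraph_exists_cliques_of_far hfin hα (a := ⟨a, ha⟩) (b := ⟨b, hb⟩) hab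
  · push Not at h
    obtain ⟨o, ho⟩ := Plane.exists_unit_disc hfin (fun a ha b hb => (h a ha b hb).le)
      (unitDiskGraph_exists_dist_le_one_of_three hfin hα)
    obtain ⟨v, hv, c, hvc, hc⟩ := Plane.exists_touching_unit_disc hfin hne ho
    exact unitDiskGraph_exists_cliques_of_touching hfin hα ⟨v, hv⟩ hvc hc

end UnitDisk

theorem lemma5p1 (V : Set Plane) (hfin : V.Finite) (hne : V.Nonempty)
    (hα : (unitDiskGraph V).indepNum ≤ 2) :
    (∃ A B C : Set V,
      (unitDiskGraph V).IsClique A ∧ (unitDiskGraph V).IsClique B ∧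
      (unitDiskGraph V).IsClique C ∧
      A ∪ B ∪ C = Set.univ ∧ (A ∩ B).Nonempty) ∧
    (∃ A B C : Set V,
      (unitDiskGraph V).IsClique A ∧ (unitDiskGraph V).IsClique B ∧
      (unitDiskGraph V).IsClique C ∧
      A ∪ B ∪ C = Set.univ ∧ Disjoint A B ∧ Disjoint A C ∧ Disjoint B C ∧
      ¬ (A.ncard = B.ncard ∧ B.ncard = C.ncard)) ∧
    cliquePartitionNumber (unitDiskGraph V) ≤ 3 := by
  have : Finite V := hfin
  have h := unitDiskGraph_exists_cliques hfin hne hα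
  obtain ⟨A, B, C, hA, hB, hC, hcover, hAB⟩ := h
  exact ⟨⟨A, B, C, hA, hB, hC, hcover, hAB⟩,
    (unitDiskGraph V).exists_clique_partition_ncard_ne hA hB hC hcover hAB,
    cliquePartitionNumber_le_three _ hA hB hC hcover⟩
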